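/- Let $n,k,r$ be integers with $n\ge 1$, $0\le k\le n$ and $r\ge 2$. Let $I_{n,k}\subseteq\mathbb{C}[x_1,\dots,x_n]$ be the ideal generated by $x_1^{kr+1},\dots,x_n^{kr+1}$ together with $e_d(x_1^r,\dots,x_n^r)$ for $n-k+1\le d\le n$, where $e_d$ is the $d$-th elementary symmetric polynomial, and let $R_{n,k}=\mathbb{C}[x_1,\dots,x_n]/I_{n,k}$. An $r$-colored word of length $m$ on $[n]$ is $g=\pi_1^{c_1}\cdots\pi_m^{c_m}$ with distinct letters $\pi_i\in[n]$ and colors $0\le c_i\le r-1$; it is an $r$-colored permutation if $m=n$. Order colored letters by $i^c<j^d$ iff $c>d$, or $c=d$ and $i<j$. Put $\mathrm{Des}(g)=\{1\le i\le m-1:\pi_i^{c_i}>\pi_{i+1}^{c_{i+1}}\}$, $\mathrm{des}(g)=|\mathrm{Des}(g)|$, $d_i(g)=|\{j\in\mathrm{Des}(g): j\ge i\}|$, and $b_g=\prod_{i=1}^m x_{\pi_i}^{r d_i(g)+c_i}$. For $S\subseteq[n]$ with $|S|=m\ge k$, the $(m,k)$-descent monomials on the variables $\{x_j:j\in S\}$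 are the monomials $b_g\, x_{\pi_1}^{r i_1}\cdots x_{\pi_{m-k}}^{r i_{m-k}}$, where $g$ is a colored word using each letter of $S$ exactly once, $\mathrm{des}(g)<k$, and $k-\mathrm{des}(g)>i_1\ge\cdots\ge i_{m-k}\ge 0$. For $k\ge1$ let $\mathcal{ED}_{n,k}$ be the set of all monomials $$\Bigl(\prod_{j=1}^z x_{\pi_j}^{kr}\Bigr)\cdot b_{\bar g}\cdot x_{\pi_{z+1}}^{r i_{z+1}}\cdots x_{\pi_{n-k}}^{r i_{n-k}},$$ where $0\le z\le n-k$, $\pi_1^{c_1}\cdots\pi_n^{c_n}$ is an $r$-colored permutation whose suffix $\bar g=\pi_{z+1}^{c_{z+1}}\cdots\pi_n^{c_n}$ has $\mathrm{des}(\bar g)<k$, and $k-\mathrm{des}(\bar g)>i_{z+1}\ge\cdots\ge i_{n-k}\ge0$. Put $\mathcal{ED}_{n,0}=\{1\}$. Theorem. The set $\mathcal{ED}_{n,k}$ of extended $(n,k)$-descent monomials descends to a $\mathbb{C}$-basis of $R_{n,k}$: the cosets of its elements, indexed by the elements of $\mathcal{ED}_{n,k}$, form a basis. Moreover, if $k\ge1$,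 a polynomial lies in $\mathcal{ED}_{n,k}$ if and only if it equals $\prod_{j\in Z}x_j^{kr}\cdot q$ for some $Z\subseteq[n]$ with $z=|Z|\le n-k$ and some $(n-z,k)$-descent monomial $q$ on the variables $\{x_j:j\notin Z\}$. -/

import Mathlib

noncomputable section

namespace DescentBasis

/-- A (partial) `r`-colored permutation `π₁^{c₁} … π_m^{c_m}` of length `m`: the letters
`π₁, …, π_m` are distinct elements of `[n]` (modelled by `Fin n`), the colors lie in
`{0, …, r - 1}`.  For `m = n` these are exactly the elements of `G_n = G(r,1,n)`. -/
structure ColoredPerm (n r m : ℕ) where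
  letter : Fin m ↪ Fin n
  color : Fin m → Fin r

/-- The order `<` on colored letters `i^c`: higher colors are smaller, and letters of the
same color are compared by value. -/
def ColoredLT {n r : ℕ} (a b : Fin n × Fin r) : Prop :=
  b.2 < a.2 ∨ (a.2 = b.2 ∧ a.1 < b.1)

namespace ColoredPerm

variable {n r m : ℕ}

/-- The colored letter in position `i`. -/
def entry (g : ColoredPerm n r m) (i : Fin m) : Fin n × Fin r := (g.letter i, g.color i)

open scoped Classical in
/-- The descent set: the positions `i`, not the last one, whose colored letter is larger
than the next one. -/
def Des (g : ColoredPerm n r m) : Finset (Fin m) :=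
  Finset.univ.filter fun i => ∃ h : (i : ℕ) + 1 < m, ColoredLT (g.entry ⟨i + 1, h⟩) (g.entry i)

/-- The number of descents. -/
def des (g : ColoredPerm n r m) : ℕ := g.Des.card

/-- `d_i(g)`: the number of descents at positions `j ≥ i`. -/
def d (g : ColoredPerm n r m) (i : Fin m) : ℕ := (g.Des.filter fun j => i ≤ j).card

/-- The descent monomial `b_g = ∏ i, x_{π_i} ^ (r d_i(g) + c_i)`. -/
def descentMonomial (g : ColoredPerm n r m) : MvPolynomial (Fin n) ℂ :=
  ∏ i : Fin m, MvPolynomial.X (g.letter i) ^ (r * g.d i + (g.color i : ℕ))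

/-- The word obtained by erasing the first `z` letters. -/
def suffix (g : ColoredPerm n r m) (z : ℕ) : ColoredPerm n r (m - z) where
  letter := ⟨fun i => g.letter ⟨z + i, by omega⟩, fun i j h => by
    have h' := congrArg Fin.val (g.letter.injective h)
    exact Fin.ext (Nat.add_left_cancel h')⟩
  color := fun i => g.color ⟨z + i, by omega⟩

/-- `b_g · x_{π_1}^{r i_1} ⋯ x_{π_{m-k}}^{r i_{m-k}}` for a word `g` of length `m`. -/
def extendedMonomial (g : ColoredPerm n r m) (k : ℕ) (e : Fin (m - k) → ℕ) :
    MvPolynomial (Fin n) ℂ :=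
  g.descentMonomial *
    ∏ j : Fin (m - k), MvPolynomial.X (g.letter (Fin.castLE (Nat.sub_le m k) j)) ^ (r * e j)

/-- The condition on `g` and on the sequence `(i_1, …, i_{m-k})` of extra exponents:
`des g < k` and `k - des g > i_1 ≥ ⋯ ≥ i_{m-k} ≥ 0`. -/
def Admissible (g : ColoredPerm n r m) (k : ℕ) (e : Fin (m - k) → ℕ) : Prop :=
  g.des < k ∧ Antitone e ∧ ∀ j, e j < k - g.des

end ColoredPerm

/-- The `(|S|, k)`-descent monomials on the variable set `{x_j : j ∈ S}`. For `S = [n]`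
this is the set `D_{n,k}`. -/
def descentMonomials (n k r : ℕ) (S : Finset (Fin n)) : Set (MvPolynomial (Fin n) ℂ) :=
  {f | ∃ (m : ℕ) (g : ColoredPerm n r m) (e : Fin (m - k) → ℕ),
    Finset.univ.map g.letter = S ∧ g.Admissible k e ∧ f = g.extendedMonomial k e}

/-- The extended `(n, k)`-descent monomials `ED_{n,k}`, with `ED_{n,0} = {1}`. -/
def extendedDescentMonomials (n k r : ℕ) : Set (MvPolynomial (Fin n) ℂ) :=
  if k = 0 then {1} else
  {f | ∃ (z : ℕ) (g : ColoredPerm n r n) (e : Fin (n - z - k) → ℕ),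
    z ≤ n - k ∧ (g.suffix z).Admissible k e ∧
    f = (∏ j ∈ Finset.univ.filter (fun j : Fin n => (j : ℕ) < z),
          MvPolynomial.X (g.letter j) ^ (k * r)) * (g.suffix z).extendedMonomial k e}

/-- `e_d(x_1^r, …, x_n^r)`. -/
def esymmPow (n r d : ℕ) : MvPolynomial (Fin n) ℂ :=
  MvPolynomial.expand r (MvPolynomial.esymm (Fin n) ℂ d)

/-- The ideal `I_{n,k}`, generated by `x_1^{kr+1}, …, x_n^{kr+1}` and `e_d(x_1^r, …, x_n^r)` for
`n - k + 1 ≤ d ≤ n`. -/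
def idealI (n k r : ℕ) : Ideal (MvPolynomial (Fin n) ℂ) :=
  Ideal.span ({f | ∃ i : Fin n, f = MvPolynomial.X i ^ (k * r + 1)} ∪
    {f | ∃ d : ℕ, n - k + 1 ≤ d ∧ d ≤ n ∧ f = esymmPow n r d})

/-- The quotient ring `R_{n,k} = ℂ[x_1, …, x_n] / I_{n,k}`. -/
abbrev ringR (n k r : ℕ) : Type := MvPolynomial (Fin n) ℂ ⧸ idealI n k r

end DescentBasis

end

/-!
Attach to an exponent vector `a` the distinct keys `n a_i + (n - 1 - i)` and sort the variables by
decreasing key. If the gap between the `d`-th largest key and the next one is at least `r n`, then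
`x^a = x^c ∏_{i ∈ S} x_i^r` with `S` the first `d` variables, and subtracting `x^c e_d(x^r)`
rewrites `x^a` in terms of monomials with a smaller sum of squares of keys. Hence the products of a
monomial having no such gap for `d > n - k` with powers of the `e_d(x^r)`, `d > n - k`, span the
polynomial ring. Such a product is determined by its leading exponent, so in bounded degree there
are no more of them than monomials, and they form a basis.

If `a_i > k r`, the same rewriting can be carried out with the elementary symmetric polynomials of
the variables other than `x_i`, which leaves the exponent of `x_i` unchanged; multiplied by
`x_i^{kr}`, these polynomials lie in the ideal of the `e_d(x^r)`. So the powers `x_i^{kr+1}` only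
kill those basis elements that are monomials with an exponent exceeding `k r`, and the monomials
without large gaps and with exponents at most `k r` form a basis of the quotient.

These monomials are the extended descent monomials: read the variables in the order of their keys
and color each by the residue of its exponent modulo `r`; the quotient by `r` then decreases
by one at each descent, and additionally by the gap of keys divided by `r n`.
-/

noncomputable section

namespace DescentBasis

open MvPolynomial Finset

section Sequences

variable {m : ℕ}

/-- The term of the sequence `f` after position `p`, with `0` as the term past the end. -/
def next (f : Fin m → ℕ) (p : Fin m) : ℕ :=
  if h : (p : ℕ) + 1 < m then f ⟨p + 1, h⟩ else 0

/-- The number of integers strictly between two consecutive terms of a strictly decreasing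
sequence; the term past the end is taken to be `-1`, so that the last gap is the last term. -/
def gap (f : Fin m → ℕ) (p : Fin m) : ℕ := f p - next (fun j => f j + 1) p

lemma next_succ_le_of_strictAnti {f : Fin m → ℕ} (hf : StrictAnti f) (p : Fin m) :
    next (fun j => f j + 1) p ≤ f p := by
  unfold next
  split_ifs
  · exact hf (Fin.lt_def.2 (Nat.lt_succ_self _))
  · exact Nat.zero_le _

lemma gap_add_lt_of_lt {f : Fin m → ℕ} (hf : StrictAnti f) {p q : Fin m} (h : p < q) :
    gap f p + f q < f p := by
  have hnext : p.val + 1 < m := by omega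
  have hle := next_succ_le_of_strictAnti hf p
  have hq : f q ≤ f ⟨p + 1, hnext⟩ := hf.antitone (Fin.le_def.2 (Nat.succ_le_of_lt h))
  simp only [gap, next, dif_pos hnext] at hle ⊢
  omega

lemma sum_Ici_eq_add_next (t : Fin m → ℕ) (p : Fin m) :
    ∑ j ∈ Ici p, t j = t p + next (fun i => ∑ j ∈ Ici i, t j) p := by
  have hIoi : next (fun i => ∑ j ∈ Ici i, t j) p = ∑ j ∈ Ioi p, t j := by
    unfold next
    split_ifs with h
    · refine congrArg (fun s => ∑ j ∈ s, t j) (Finset.ext fun j => ?_)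
      simp only [mem_Ici, mem_Ioi, Fin.le_def, Fin.lt_def]
      omega
    · refine (sum_eq_zero fun j hj => absurd (Fin.lt_def.1 (mem_Ioi.1 hj)) ?_).symm
      omega
  rw [hIoi, ← Finset.Ioi_insert, sum_insert (by simp)]

lemma eq_sum_Ici_of_eq_add_next {f t : Fin m → ℕ} (h : ∀ p, f p = t p + next f p) (p : Fin m) :
    f p = ∑ j ∈ Ici p, t j := by
  rw [h, sum_Ici_eq_add_next, next, next]
  split_ifs
  · rw [eq_sum_Ici_of_eq_add_next h]
  · rfl
termination_by m - p

lemma antitone_sum_Ici (t : Fin m → ℕ) : Antitone fun p => ∑ j ∈ Ici p, t j :=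
  fun _ _ h => sum_le_sum_of_subset (Ici_subset_Ici.2 h)

lemma gap_add_mul_sum_Ici {f : Fin m → ℕ} (hf : StrictAnti f) (s : ℕ) (t : Fin m → ℕ)
    (p : Fin m) : gap (fun p => f p + s * ∑ j ∈ Ici p, t j) p = gap f p + s * t p := by
  have hle := next_succ_le_of_strictAnti hf p
  simp only [gap, sum_Ici_eq_add_next t p, mul_add]
  simp only [next] at hle ⊢
  split_ifs at hle ⊢ <;> omega

section Division

variable {f q κ : Fin m → ℕ} {s : ℕ}

lemma gap_div_eq (hfq : ∀ p, f p = s * q p + κ p) (hκ : ∀ p, κ p < s)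
    (hinj : Function.Injective κ) {p : Fin m} {t : ℕ}
    (h : q p = t + (if κ p < next κ p then 1 else 0) + next q p) : gap f p / s = t := by
  have hp := hκ p
  suffices s * t ≤ gap f p ∧ gap f p < s * t + s by
    rw [Nat.div_eq_of_lt_le] <;> nlinarith
  rw [gap, hfq p, h]
  unfold next
  split_ifs with h₁ h₂ h₂
  · have := hκ ⟨p + 1, h₁⟩
    simp only [hfq ⟨p + 1, h₁⟩, mul_add]
    omega
  · have hne : κ p ≠ κ ⟨p + 1, h₁⟩ := fun he => by simpa [Fin.ext_iff] using hinj he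
    simp only [hfq ⟨p + 1, h₁⟩, mul_add]
    omega
  · omega
  · simp only [add_zero, tsub_zero]
    omega

lemma eq_gap_div_add_next (hf : StrictAnti f) (hfq : ∀ p, f p = s * q p + κ p)
    (hκ : ∀ p, κ p < s) (hinj : Function.Injective κ) (p : Fin m) :
    q p = gap f p / s + (if κ p < next κ p then 1 else 0) + next q p := by
  suffices hle : (if κ p < next κ p then 1 else 0) + next q p ≤ q p by
    obtain ⟨t, ht⟩ := Nat.exists_eq_add_of_le' hle
    rw [← add_assoc] at ht
    rw [gap_div_eq hfq hκ hinj ht, ← ht]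
  unfold next
  split_ifs with h₁ h₂ h₂
  · have := hf (a := p) (b := ⟨p + 1, h₁⟩) (Fin.lt_def.2 (Nat.lt_succ_self _))
    rw [hfq, hfq] at this
    by_contra! hlt
    nlinarith
  · have := hf (a := p) (b := ⟨p + 1, h₁⟩) (Fin.lt_def.2 (Nat.lt_succ_self _))
    rw [hfq, hfq] at this
    by_contra! hlt
    have := hκ p
    nlinarith
  · simp at h₂
  · simp

end Division

end Sequences

section Keys

variable {n : ℕ}

/-- The keys order the variables by decreasing exponent, ties being broken by the index. -/
def key (a : Fin n →₀ ℕ) (i : Fin n) : ℕ := n * a i + i.rev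

lemma key_div (a : Fin n →₀ ℕ) (i : Fin n) : key a i / n = a i := by
  rw [key, Nat.mul_add_div i.pos, Nat.div_eq_of_lt i.rev.isLt, add_zero]

lemma key_injective (a : Fin n →₀ ℕ) : Function.Injective (key a) := by
  intro i j h
  have hmod := congrArg (· % n) h
  simp only [key, Nat.mul_add_mod, Nat.mod_eq_of_lt (Fin.isLt _)] at hmod
  exact Fin.rev_injective (Fin.ext hmod)

/-- The exponent vector of `∏ i ∈ S, x_i ^ r`. -/
def block (r : ℕ) (S : Finset (Fin n)) : Fin n →₀ ℕ := ∑ i ∈ S, Finsupp.single i r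

lemma block_apply (r : ℕ) (S : Finset (Fin n)) (i : Fin n) :
    block r S i = if i ∈ S then r else 0 := by
  simp [block, Finsupp.finsetSum_apply, Finsupp.single_apply]

lemma degree_block (r : ℕ) (S : Finset (Fin n)) : (block r S).degree = #S * r := by
  simp [block]

lemma key_add_block (r : ℕ) (a : Fin n →₀ ℕ) (S : Finset (Fin n)) (i : Fin n) :
    key (a + block r S) i = key a i + if i ∈ S then r * n else 0 := by
  simp only [key, Finsupp.add_apply, block_apply]
  split_ifs <;> ring

/-- The variables in the order of decreasing keys. -/
def order (a : Fin n →₀ ℕ) : Equiv.Perm (Fin n) := Tuple.sort fun i => OrderDual.toDual (key a i)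

lemma strictAnti_key_order (a : Fin n →₀ ℕ) : StrictAnti fun p => key a (order a p) := by
  have hmono : Monotone fun p => OrderDual.toDual (key a (order a p)) :=
    Tuple.monotone_sort fun i => OrderDual.toDual (key a i)
  exact Antitone.strictAnti_of_injective hmono ((key_injective a).comp (order a).injective)

lemma order_eq_of_strictAnti {a : Fin n →₀ ℕ} {σ : Equiv.Perm (Fin n)}
    (h : StrictAnti fun p => key a (σ p)) : order a = σ := by
  have hcomp : key a ∘ order a = key a ∘ σ :=
    Tuple.unique_antitone (strictAnti_key_order a).antitone h.antitone
  exact Equiv.ext fun p => key_injective a (congrFun hcomp p)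

/-- The first `p + 1` variables in the order of decreasing keys. -/
def top (a : Fin n →₀ ℕ) (p : Fin n) : Finset (Fin n) := (Iic p).map (order a).toEmbedding

lemma card_top (a : Fin n →₀ ℕ) (p : Fin n) : #(top a p) = p + 1 := by simp [top]

lemma mem_top {a : Fin n →₀ ℕ} {p i : Fin n} : i ∈ top a p ↔ (order a).symm i ≤ p := by
  simp [top]

/-- The gap between the `p`-th largest key and the next one. -/
def keyGap (a : Fin n →₀ ℕ) (p : Fin n) : ℕ := gap (fun p => key a (order a p)) p

/-- The exponent vectors that are not the leading exponent of a multiple of `e_d(x^r)` with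
`N < d`, see `exists_eq_add_block_of_le_keyGap`. -/
def Reduced (N r : ℕ) (a : Fin n →₀ ℕ) : Prop := ∀ p : Fin n, N ≤ p → keyGap a p < r * n

lemma exists_eq_add_block_of_le_keyGap {r : ℕ} {a : Fin n →₀ ℕ} {p : Fin n}
    (h : r * n ≤ keyGap a p) :
    ∃ c, ∃ S : Finset (Fin n), a = c + block r S ∧ #S = p + 1 ∧
      ∀ i ∈ S, ∀ j ∉ S, key c j < key c i := by
  have hanti := strictAnti_key_order a
  have htop : ∀ i ∈ top a p, key a (order a p) ≤ key a i := fun i hi => by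
    simpa using hanti.antitone (mem_top.1 hi)
  have hle : block r (top a p) ≤ a := fun i => by
    rw [block_apply]
    split_ifs with hi
    · rw [← key_div a i, Nat.le_div_iff_mul_le i.pos]
      exact h.trans ((Nat.sub_le _ _).trans (htop i hi))
    · exact Nat.zero_le _
  refine ⟨a - block r (top a p), top a p, (tsub_add_cancel_of_le hle).symm, card_top a p,
    fun i hi j hj => ?_⟩
  have hgap : keyGap a p + key a j < key a (order a p) := by
    simpa [keyGap] using gap_add_lt_of_lt hanti (not_le.1 (mem_top.not.1 hj))
  have hkey := key_add_block r (a - block r (top a p)) (top a p)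
  rw [tsub_add_cancel_of_le hle] at hkey
  have := htop i hi
  have := hkey i
  have := hkey j
  simp only [hi, hj, if_true, if_false] at *
  omega

end Keys

section Straightening

variable {n : ℕ}

/-- A strictly convex measure of exponent vectors, which decreases when a block of exponents is
moved from the variables with the largest keys to other ones. -/
def weight (a : Fin n →₀ ℕ) : ℕ := ∑ i, key a i ^ 2

lemma weight_add_block (r : ℕ) (a : Fin n →₀ ℕ) (S : Finset (Fin n)) :
    weight (a + block r S) = weight a + 2 * (r * n) * ∑ i ∈ S, key a i + #S * (r * n) ^ 2 := by
  have hsq : ∀ i, key (a + block r S) i ^ 2 =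
      key a i ^ 2 + if i ∈ S then 2 * (r * n) * key a i + (r * n) ^ 2 else 0 := by
    intro i
    rw [key_add_block]
    split_ifs <;> ring
  simp only [weight, hsq, sum_add_distrib, sum_ite_mem, univ_inter, sum_const, smul_eq_mul,
    mul_sum]
  ring

lemma sum_lt_sum_of_separated {ι : Type*} [DecidableEq ι] {f : ι → ℕ} {S T : Finset ι}
    (hcard : #T = #S) (hne : T ≠ S) (h : ∀ i ∈ S, ∀ j ∈ T \ S, f j < f i) :
    ∑ i ∈ T, f i < ∑ i ∈ S, f i := by
  have hsdiff : #(T \ S) = #(S \ T) := card_sdiff_comm hcard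
  have hpos : 0 < #(S \ T) := by
    rw [card_pos, sdiff_nonempty]
    exact fun hs => hne (eq_of_subset_of_card_le hs hcard.le).symm
  have hT : ∑ i ∈ T \ S, f i ≤ #(T \ S) • (T \ S).sup f :=
    sum_le_card_nsmul _ _ _ fun j hj => le_sup hj
  have hS : #(S \ T) • ((T \ S).sup f + 1) ≤ ∑ i ∈ S \ T, f i := by
    refine card_nsmul_le_sum _ _ _ fun i hi => Nat.succ_le_of_lt ?_
    obtain ⟨j, hj, hsup⟩ := exists_mem_eq_sup (T \ S) (card_pos.1 (hsdiff ▸ hpos)) f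
    exact hsup ▸ h i (mem_sdiff.1 hi).1 j hj
  rw [← sum_inter_add_sum_sdiff T S f, ← sum_inter_add_sum_sdiff S T f, inter_comm S T]
  simp only [smul_eq_mul, hsdiff] at hT hS
  nlinarith

lemma weight_add_block_lt_of_separated {r : ℕ} (hr : 0 < r) {c : Fin n →₀ ℕ}
    {S T : Finset (Fin n)} (hcard : #T = #S) (hne : T ≠ S)
    (h : ∀ i ∈ S, ∀ j ∈ T \ S, key c j < key c i) :
    weight (c + block r T) < weight (c + block r S) := by
  have hn : 0 < n := Nat.pos_of_ne_zero (by rintro rfl; exact hne (Subsingleton.elim T S))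
  rw [weight_add_block, weight_add_block, hcard]
  gcongr
  exact sum_lt_sum_of_separated hcard hne h

variable (R : Type*) [CommRing R]

/-- The `d`-th elementary symmetric polynomial in the `r`-th powers of the variables in `U`. -/
def esymmOn (r : ℕ) (U : Finset (Fin n)) (d : ℕ) : MvPolynomial (Fin n) R :=
  ∑ T ∈ powersetCard d U, monomial (block r T) 1

variable {R}

lemma monomial_block (r : ℕ) (S : Finset (Fin n)) :
    monomial (block r S) (1 : R) = ∏ i ∈ S, X i ^ r := by
  simp [block, monomial_sum_one, X_pow_eq_monomial]

lemma esymmOn_univ (r d : ℕ) : esymmOn R r univ d = expand r (esymm (Fin n) R d) := by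
  simp [esymmOn, esymm, monomial_block]

lemma esymmOn_insert (r d : ℕ) {U : Finset (Fin n)} {i : Fin n} (hi : i ∉ U) :
    esymmOn R r (insert i U) (d + 1) =
      esymmOn R r U (d + 1) + X i ^ r * esymmOn R r U d := by
  have hmem : ∀ T ∈ powersetCard d U, i ∉ T := fun T hT h => hi ((mem_powersetCard.1 hT).1 h)
  have hdisj : Disjoint (powersetCard (d + 1) U) ((powersetCard d U).image (insert i)) := by
    simp only [disjoint_left, mem_image, mem_powersetCard]
    rintro _ ⟨hTU, -⟩ ⟨T, -, rfl⟩
    exact hi (hTU (mem_insert_self i T))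
  have hinj : Set.InjOn (insert i) (powersetCard d U : Set (Finset (Fin n))) :=
    fun T hT T' hT' h => by rw [← erase_insert (hmem T hT), h, erase_insert (hmem T' hT')]
  simp only [esymmOn, powersetCard_succ_insert hi, sum_union hdisj, sum_image hinj, mul_sum]
  congr 1
  refine sum_congr rfl fun T hT => ?_
  rw [monomial_block, monomial_block, prod_insert (hmem T hT)]

lemma monomial_mul_esymmOn (r : ℕ) (c : Fin n →₀ ℕ) {U S : Finset (Fin n)} (hS : S ⊆ U) :
    monomial c (1 : R) * esymmOn R r U #S = monomial (c + block r S) 1 +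
      ∑ T ∈ (powersetCard #S U).erase S, monomial (c + block r T) 1 := by
  rw [add_sum_erase _ (fun T => monomial (c + block r T) (1 : R)) (mem_powersetCard.2 ⟨hS, rfl⟩)]
  simp [esymmOn, mul_sum, monomial_mul]

lemma monomial_add_block_mem_of_separated {r : ℕ} (hr : 0 < r) {c : Fin n →₀ ℕ}
    {U S : Finset (Fin n)} (hSU : S ⊆ U) (hsep : ∀ i ∈ S, ∀ j ∈ U \ S, key c j < key c i)
    (V : Submodule R (MvPolynomial (Fin n) R)) (hmul : monomial c 1 * esymmOn R r U #S ∈ V)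
    (hlt : ∀ b, weight b < weight (c + block r S) → (∀ i ∉ U, b i = (c + block r S) i) →
      b.degree = (c + block r S).degree → monomial b 1 ∈ V) :
    monomial (c + block r S) 1 ∈ V := by
  rw [← sub_eq_of_eq_add (monomial_mul_esymmOn r c hSU)]
  refine V.sub_mem hmul (V.sum_mem fun T hT => ?_)
  obtain ⟨hne, hTU, hcard⟩ : T ≠ S ∧ T ⊆ U ∧ #T = #S := by simpa using hT
  refine hlt _ ?_ (fun i hi => ?_) ?_
  · exact weight_add_block_lt_of_separated hr hcard hne fun i hi j hj =>
      hsep i hi j (sdiff_subset_sdiff hTU subset_rfl hj)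
  · simp [block_apply, mt (@hTU i) hi, mt (@hSU i) hi]
  · simp only [map_add, degree_block, hcard]

end Straightening

section Ideals

variable {n : ℕ} (R : Type*) [CommRing R]

/-- The ideal generated by the polynomials `e_d(x_1^r, …, x_n^r)` with `N < d`. -/
def symmetricIdeal (n N r : ℕ) : Ideal (MvPolynomial (Fin n) R) :=
  Ideal.span (esymmOn R r univ '' Set.Ioc N n)

/-- The ideal generated by the powers `x_i^{M+1}` and the polynomials `e_d(x_1^r, …, x_n^r)` with
`N < d`; the ideal `I_{n,k}` is the case `N = n - k`, `M = k r`. -/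
def truncatedIdeal (n N r M : ℕ) : Ideal (MvPolynomial (Fin n) R) :=
  Ideal.span (Set.range fun i => X i ^ (M + 1)) ⊔ symmetricIdeal R n N r

/-- The span of the monomials with reduced exponents of which at least one exceeds `M`. -/
def overflowSpan (n N r M : ℕ) : Submodule R (MvPolynomial (Fin n) R) :=
  Submodule.span R ((fun a => monomial a 1) '' {a | Reduced N r a ∧ ∃ i, M < a i})

variable {R} {N r M : ℕ}

lemma esymmOn_univ_mem_symmetricIdeal {d : ℕ} (hd : N < d) :
    esymmOn R r univ d ∈ symmetricIdeal R n N r := by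
  by_cases h : d ≤ n
  · exact Ideal.subset_span ⟨d, ⟨hd, h⟩, rfl⟩
  · rw [esymmOn, powersetCard_eq_empty.2 (by simpa using h), sum_empty]
    exact zero_mem _

lemma pow_mul_esymmOn_erase_mem_symmetricIdeal (i : Fin n) (j : ℕ) {d : ℕ} (hd : N ≤ d)
    (hj : n ≤ d + j) : X i ^ (j * r) * esymmOn R r (univ.erase i) d ∈ symmetricIdeal R n N r := by
  induction j generalizing d with
  | zero =>
    have := i.isLt
    have hcard : #(univ.erase i) < d := by
      rw [card_erase_of_mem (mem_univ i), card_fin]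
      omega
    rw [esymmOn, powersetCard_eq_empty.2 hcard, sum_empty, mul_zero]
    exact zero_mem _
  | succ j ih =>
    have hsplit := esymmOn_insert (R := R) r d (notMem_erase i univ)
    rw [insert_erase (mem_univ i)] at hsplit
    have hrec : X i ^ ((j + 1) * r) * esymmOn R r (univ.erase i) d =
        X i ^ (j * r) * esymmOn R r univ (d + 1) -
          X i ^ (j * r) * esymmOn R r (univ.erase i) (d + 1) := by
      rw [hsplit]; ring
    rw [hrec]
    exact Ideal.sub_mem _
      (Ideal.mul_mem_left _ _ (esymmOn_univ_mem_symmetricIdeal (by omega)))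
      (ih (by omega) (by omega))

lemma monomial_mul_mem_of_le (I : Ideal (MvPolynomial (Fin n) R)) {i : Fin n} {c : Fin n →₀ ℕ}
    {s : ℕ} {f : MvPolynomial (Fin n) R} (hs : s ≤ c i) (hf : X i ^ s * f ∈ I) :
    monomial c 1 * f ∈ I := by
  rw [← tsub_add_cancel_of_le (Finsupp.single_le_iff.2 hs), monomial_add_single, mul_assoc]
  exact I.mul_mem_left _ hf

lemma block_eq_add_block_erase (r : ℕ) (S : Finset (Fin n)) (i : Fin n) :
    block r S = block r (S ∩ {i}) + block r (S.erase i) := by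
  rw [block, ← sum_inter_add_sum_sdiff S {i}, sdiff_singleton_eq_erase, block, block]

lemma monomial_mem_symmetricIdeal_sup_of_lt (hr : 0 < r) (hM : (n - N) * r ≤ M) {i : Fin n}
    (a : Fin n →₀ ℕ) (hi : M < a i) :
    monomial a 1 ∈ (symmetricIdeal R n N r).restrictScalars R ⊔ overflowSpan R n N r M := by
  induction a using (measure weight).wf.induction with | _ a ih
  by_cases hred : Reduced N r a
  · exact Submodule.mem_sup_right (Submodule.subset_span ⟨a, ⟨hred, i, hi⟩, rfl⟩)
  obtain ⟨p, hNp, hp⟩ : ∃ p : Fin n, N ≤ p ∧ r * n ≤ keyGap a p := by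
    simpa [Reduced] using hred
  obtain ⟨c, S, hc, hcard, hsep⟩ := exists_eq_add_block_of_le_keyGap hp
  have ha : a = c + block r (S ∩ {i}) + block r (S.erase i) := by
    rw [hc, block_eq_add_block_erase r S i, add_assoc]
  -- Straightening with the variables other than `x_i` only keeps the exponent of `x_i` above `M`.
  rw [ha] at hi ⊢
  have hN : N ≤ #(S.erase i) := by
    have := pred_card_le_card_erase (s := S) (a := i)
    omega
  refine monomial_add_block_mem_of_separated hr (erase_subset_erase i (subset_univ S)) ?_ _ ?_ ?_
  · intro j hj l hl
    obtain ⟨hji, hjS⟩ := mem_erase.1 hj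
    obtain ⟨hli, hlS⟩ : l ≠ i ∧ l ∉ S := by
      simp only [mem_sdiff, mem_erase, mem_univ, and_true, not_and] at hl
      exact ⟨hl.1, hl.2 hl.1⟩
    simpa [key_add_block, hji, hli] using hsep j hjS l hlS
  · refine Submodule.mem_sup_left (monomial_mul_mem_of_le _ (i := i) (s := (n - N) * r) ?_ <|
      pow_mul_esymmOn_erase_mem_symmetricIdeal i _ hN (by omega))
    simp only [Finsupp.add_apply, block_apply, notMem_erase, if_false] at hi ⊢
    omega
  · intro b hb hbi _
    exact ih b (ha ▸ hb) (by rwa [hbi i (notMem_erase i univ)])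

lemma span_range_monomial :
    Submodule.span R (Set.range fun a : Fin n →₀ ℕ => monomial a (1 : R)) = ⊤ := by
  rw [← (basisMonomials (Fin n) R).span_eq, coe_basisMonomials]

lemma truncatedIdeal_le (hr : 0 < r) (hM : (n - N) * r ≤ M) :
    (truncatedIdeal R n N r M).restrictScalars R ≤
      (symmetricIdeal R n N r).restrictScalars R ⊔ overflowSpan R n N r M := by
  rw [truncatedIdeal, Submodule.restrictScalars_sup]
  refine sup_le ?_ le_sup_left
  rw [Ideal.span, ← Submodule.span_smul_of_span_eq_top span_range_monomial, Submodule.span_le]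
  rintro _ ⟨_, ⟨a, rfl⟩, _, ⟨i, rfl⟩, rfl⟩
  simp only [smul_eq_mul, X_pow_eq_monomial, monomial_mul, one_mul]
  exact monomial_mem_symmetricIdeal_sup_of_lt hr hM (i := i) _ <| by
    rw [Finsupp.add_apply, Finsupp.single_eq_same]
    omega

lemma monomial_mem_truncatedIdeal_of_lt {a : Fin n →₀ ℕ} {i : Fin n} (h : M < a i) :
    monomial a 1 ∈ truncatedIdeal R n N r M := by
  rw [← mul_one (monomial a (1 : R))]
  refine monomial_mul_mem_of_le _ (Nat.succ_le_of_lt h) ?_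
  rw [mul_one]
  exact Ideal.mem_sup_left (Ideal.subset_span ⟨i, rfl⟩)

end Ideals

section Raise

variable {n : ℕ}

/-- The exponent vector obtained from `a` by raising, for every `p`, the exponents of the first
`p + 1` variables in the order of `a` by `m p * r`. It is the leading exponent of the product of
`x^a` with the `m p`-th powers of the polynomials `e_{p+1}(x_1^r, …, x_n^r)`. -/
def raise (r : ℕ) (a : Fin n →₀ ℕ) (m : Fin n → ℕ) : Fin n →₀ ℕ :=
  a + ∑ p, m p • block r (top a p)

variable (r : ℕ) (a : Fin n →₀ ℕ) (m : Fin n → ℕ)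

lemma raise_zero : raise r a 0 = a := by simp [raise]

lemma raise_order (p : Fin n) : raise r a m (order a p) = a (order a p) + r * ∑ j ∈ Ici p, m j := by
  have hfilter : Ici p = univ.filter (p ≤ ·) := by ext; simp
  simp only [raise, Finsupp.add_apply, Finsupp.finsetSum_apply, Finsupp.smul_apply, block_apply,
    mem_top, Equiv.symm_apply_apply, smul_eq_mul, hfilter, sum_filter, mul_sum]
  congr 1
  exact sum_congr rfl fun j _ => by split_ifs <;> ring

lemma key_raise_order (p : Fin n) :
    key (raise r a m) (order a p) = key a (order a p) + r * n * ∑ j ∈ Ici p, m j := by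
  rw [key, raise_order, key]
  ring

lemma order_raise : order (raise r a m) = order a := by
  refine order_eq_of_strictAnti fun p q h => ?_
  simp only [key_raise_order]
  exact add_lt_add_of_lt_of_le (strictAnti_key_order a h)
    (Nat.mul_le_mul_left _ (antitone_sum_Ici m h.le))

lemma keyGap_raise (p : Fin n) : keyGap (raise r a m) p = keyGap a p + r * n * m p := by
  simp only [keyGap, order_raise, key_raise_order]
  exact gap_add_mul_sum_Ici (strictAnti_key_order a) _ _ _

lemma degree_raise : (raise r a m).degree = a.degree + ∑ p, m p * ((p + 1) * r) := by
  simp [raise, degree_block, card_top]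

variable {r a m}

lemma raise_injective {N : ℕ} {a' : Fin n →₀ ℕ} {m' : Fin n → ℕ}
    (ha : Reduced N r a) (ha' : Reduced N r a') (hm : ∀ p : Fin n, m p ≠ 0 → N ≤ p)
    (hm' : ∀ p : Fin n, m' p ≠ 0 → N ≤ p) (h : raise r a m = raise r a' m') : a = a' ∧ m = m' := by
  have hmm : m = m' := by
    funext p
    by_cases hp : N ≤ p
    · have hlt := ha p hp
      have hgap := congrArg (fun b => keyGap b p / (r * n)) h
      simpa [keyGap_raise, Nat.add_mul_div_left, pos_of_gt hlt, Nat.div_eq_of_lt, hlt, ha' p hp]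
        using hgap
    · rw [of_not_not (mt (hm p) hp), of_not_not (mt (hm' p) hp)]
  have horder : order a = order a' := by rw [← order_raise r a m, h, order_raise]
  refine ⟨Finsupp.ext fun i => ?_, hmm⟩
  obtain ⟨p, rfl⟩ := (order a).surjective i
  have hp := raise_order r a m p
  rw [h, horder, raise_order, hmm] at hp
  rw [horder]
  omega

end Raise

section NormalElements

variable {n : ℕ} {R : Type*} [CommRing R] {N r : ℕ}

/-- The indices of a basis of the polynomial ring adapted to `symmetricIdeal R n N r`: a reduced
exponent vector, and for each `p ≥ N` the exponent of the polynomial `e_{p+1}(x_1^r, …, x_n^r)`. -/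
def NormalIndex (n N r : ℕ) : Type :=
  {p : (Fin n →₀ ℕ) × (Fin n → ℕ) // Reduced N r p.1 ∧ ∀ j : Fin n, p.2 j ≠ 0 → N ≤ j}

variable (R) in
/-- The element of the adapted basis of the polynomial ring with the given index. -/
def normalElt (p : NormalIndex n N r) : MvPolynomial (Fin n) R :=
  monomial p.1.1 1 * ∏ j : Fin n, esymmOn R r univ (j + 1) ^ p.1.2 j

/-- The leading exponent of `normalElt R p`. -/
def lead (p : NormalIndex n N r) : Fin n →₀ ℕ := raise r p.1.1 p.1.2

lemma lead_injective : Function.Injective (lead : NormalIndex n N r → Fin n →₀ ℕ) := by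
  rintro ⟨⟨a, m⟩, ha, hm⟩ ⟨⟨a', m'⟩, ha', hm'⟩ h
  obtain ⟨rfl, rfl⟩ := raise_injective ha ha' hm hm' h
  rfl

/-- The index of the normal element `x^a`. -/
def NormalIndex.ofReduced {a : Fin n →₀ ℕ} (ha : Reduced N r a) : NormalIndex n N r :=
  ⟨(a, 0), ha, fun _ h => absurd rfl h⟩

lemma normalElt_ofReduced {a : Fin n →₀ ℕ} (ha : Reduced N r a) :
    normalElt R (NormalIndex.ofReduced ha) = monomial a 1 := by
  simp [normalElt, NormalIndex.ofReduced]

lemma lead_ofReduced {a : Fin n →₀ ℕ} (ha : Reduced N r a) :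
    lead (NormalIndex.ofReduced ha) = a := raise_zero r a

lemma exists_normalElt_mul_esymmOn (p : NormalIndex n N r) {j : Fin n} (hj : N ≤ j) :
    ∃ p' : NormalIndex n N r, p'.1.2 ≠ 0 ∧ (lead p').degree = (lead p).degree + (j + 1) * r ∧
      normalElt R p' = normalElt R p * esymmOn R r univ (j + 1) := by
  obtain ⟨⟨a, m⟩, ha, hm⟩ := p
  refine ⟨⟨(a, m + Pi.single j 1), ha, fun l hl => ?_⟩, fun h => ?_, ?_, ?_⟩
  · rcases eq_or_ne l j with rfl | hlj
    · exact hj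
    · exact hm l (by simpa [hlj] using hl)
  · simpa using congrFun h j
  · simp [lead, degree_raise, add_mul, sum_add_distrib, Pi.single_apply, add_assoc]
  · have hsingle : ∏ l : Fin n, esymmOn R r (univ : Finset (Fin n)) (l + 1) ^
        (Pi.single j 1 : Fin n → ℕ) l = esymmOn R r univ (j + 1) := by
      rw [prod_eq_single j] <;> simp +contextual
    simp only [normalElt, Pi.add_apply, pow_add, prod_mul_distrib, hsingle, mul_assoc]

lemma mul_mem_span_image {ι A : Type*} [Semiring A] [Algebra R A] {v : ι → A} {s t : Set ι}
    {f g : A} (h : ∀ p ∈ s, ∃ p' ∈ t, v p' = v p * g) (hf : f ∈ Submodule.span R (v '' s)) :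
    f * g ∈ Submodule.span R (v '' t) := by
  have hle : Submodule.span R (v '' s) ≤
      (Submodule.span R (v '' t)).comap (LinearMap.mulRight R g) := by
    rw [Submodule.span_le]
    rintro _ ⟨p, hp, rfl⟩
    obtain ⟨p', hp', hmul⟩ := h p hp
    exact Submodule.subset_span ⟨p', hp', hmul⟩
  exact hle hf

lemma monomial_mem_span_normalElt (hr : 0 < r) (a : Fin n →₀ ℕ) : monomial a 1 ∈
    Submodule.span R (normalElt R '' {p : NormalIndex n N r | (lead p).degree = a.degree}) := by
  induction a using (measure weight).wf.induction with | _ a ih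
  by_cases hred : Reduced N r a
  · exact Submodule.subset_span
      ⟨.ofReduced hred, congrArg _ (lead_ofReduced hred), normalElt_ofReduced hred⟩
  obtain ⟨p, hNp, hp⟩ : ∃ p : Fin n, N ≤ p ∧ r * n ≤ keyGap a p := by
    simpa [Reduced] using hred
  obtain ⟨c, S, hc, hcard, hsep⟩ := exists_eq_add_block_of_le_keyGap hp
  have hdeg : a.degree = c.degree + (p + 1) * r := by rw [hc, map_add, degree_block, hcard]
  have hweight : weight c < weight a := by
    have := p.pos
    rw [hc, weight_add_block, hcard]
    have : 0 < (p + 1 : ℕ) * (r * n) ^ 2 := by positivity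
    omega
  rw [hc]
  refine monomial_add_block_mem_of_separated hr (subset_univ S) (fun i hi j hj =>
    hsep i hi j (mem_sdiff.1 hj).2) _ ?_ fun b hb _ hbdeg => ?_
  · rw [← hc, hcard]
    refine mul_mem_span_image (fun q hq => ?_) (ih c hweight)
    obtain ⟨q', -, hq', h⟩ := exists_normalElt_mul_esymmOn (R := R) q hNp
    exact ⟨q', by rw [Set.mem_ofPred_eq] at *; omega, h⟩
  · rw [← hbdeg]
    exact ih b (hc ▸ hb)

lemma symmetricIdeal_le_span_normalElt (hr : 0 < r) : (symmetricIdeal R n N r).restrictScalars R ≤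
    Submodule.span R (normalElt R '' {p : NormalIndex n N r | p.1.2 ≠ 0}) := by
  rw [symmetricIdeal, Ideal.span, ← Submodule.span_smul_of_span_eq_top span_range_monomial,
    Submodule.span_le]
  rintro _ ⟨_, ⟨a, rfl⟩, _, ⟨d, ⟨hNd, hdn⟩, rfl⟩, rfl⟩
  obtain ⟨j, rfl⟩ := Nat.exists_eq_succ_of_ne_zero (Nat.ne_zero_of_lt hNd)
  refine mul_mem_span_image (fun p _ => ?_) (monomial_mem_span_normalElt (N := N) hr a)
  obtain ⟨p', hp', -, hmul⟩ :=
    exists_normalElt_mul_esymmOn (R := R) p (j := ⟨j, hdn⟩) (Nat.le_of_lt_succ hNd)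
  exact ⟨p', hp', hmul⟩

end NormalElements

section Bases

section LinearIndependence

variable {ι R M : Type*} [CommRing R] [AddCommGroup M] [Module R M] {v w : ι → M}

lemma linearIndependent_of_mem_span_range [Finite ι] (hw : LinearIndependent R w)
    (hmem : ∀ i, w i ∈ Submodule.span R (Set.range v)) : LinearIndependent R v := by
  rw [linearIndependent_iff_injective_finsuppLinearCombination] at *
  have hrange : ∀ l, Finsupp.linearCombination R w l ∈
      LinearMap.range (Finsupp.linearCombination R v) := fun l => by
    rw [Finsupp.range_linearCombination, Finsupp.linearCombination_apply]
    exact Submodule.sum_mem _ fun i _ => Submodule.smul_mem _ _ (hmem i)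
  rw [← LinearMap.injective_rangeRestrict_iff]
  exact OrzechProperty.injective_of_surjective_of_injective
    ((Finsupp.linearCombination R w).codRestrict _ hrange) _
    ((LinearMap.injective_codRestrict_iff _).2 hw) (LinearMap.surjective_rangeRestrict _)

lemma linearIndependent_of_mem_span_image_le (hw : LinearIndependent R w) (D : ι → ℕ)
    (hD : ∀ d, {i | D i ≤ d}.Finite)
    (hmem : ∀ i, w i ∈ Submodule.span R (v '' {j | D j ≤ D i})) : LinearIndependent R v := by
  refine linearIndependent_iff_finset_linearIndependent.2 fun s => ?_
  have : Finite {i | D i ≤ s.sup D} := hD _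
  have hbounded : LinearIndepOn R v {i | D i ≤ s.sup D} := by
    refine linearIndependent_of_mem_span_range (hw.comp _ Subtype.val_injective) fun i => ?_
    rw [← Set.image_eq_range]
    have hsub : {j | D j ≤ D i} ⊆ {j | D j ≤ s.sup D} := fun j hj => hj.out.trans i.2.out
    exact Submodule.span_mono (Set.image_mono hsub) (hmem i)
  exact hbounded.mono fun i hi => Set.mem_ofPred.2 (le_sup (f := D) (mem_coe.1 hi))

end LinearIndependence

variable {n : ℕ} {R : Type*} [CommRing R] {N r M : ℕ}

lemma linearIndependent_normalElt (hr : 0 < r) :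
    LinearIndependent R (normalElt R : NormalIndex n N r → MvPolynomial (Fin n) R) := by
  have hlead : LinearIndependent R fun p : NormalIndex n N r => monomial (lead p) (1 : R) := by
    simpa [Function.comp_def] using
      (basisMonomials (Fin n) R).linearIndependent.comp _ lead_injective
  refine linearIndependent_of_mem_span_image_le hlead (fun p => (lead p).degree)
    (fun d => (Finsupp.finite_of_degree_le d).preimage lead_injective.injOn) fun p => ?_
  exact Submodule.span_mono (Set.image_mono fun q hq => hq.le) (monomial_mem_span_normalElt hr _)

/-- The reduced exponent vectors bounded by `M`. -/
def standardExponents (n N r M : ℕ) : Set (Fin n →₀ ℕ) := {a | Reduced N r a ∧ ∀ i, a i ≤ M}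

lemma truncatedIdeal_le_span_normalElt (hr : 0 < r) (hM : (n - N) * r ≤ M) :
    (truncatedIdeal R n N r M).restrictScalars R ≤
      Submodule.span R
        (normalElt R '' {p : NormalIndex n N r | ¬ (p.1.2 = 0 ∧ ∀ i, p.1.1 i ≤ M)}) := by
  refine (truncatedIdeal_le hr hM).trans (sup_le ?_ ?_)
  · exact (symmetricIdeal_le_span_normalElt hr).trans
      (Submodule.span_mono (Set.image_mono fun p hp h => hp h.1))
  · refine Submodule.span_mono ?_
    rintro _ ⟨a, ⟨hred, i, hi⟩, rfl⟩
    exact ⟨.ofReduced hred, fun h => (h.2 i).not_gt hi, normalElt_ofReduced hred⟩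

lemma normalElt_mem_symmetricIdeal {p : NormalIndex n N r} (hp : p.1.2 ≠ 0) :
    normalElt R p ∈ symmetricIdeal R n N r := by
  obtain ⟨j, hj⟩ := Function.ne_iff.1 hp
  refine Ideal.mul_mem_left _ _ (Ideal.mem_of_dvd _ (dvd_prod_of_mem _ (mem_univ j)) ?_)
  exact Ideal.pow_mem_of_mem _ (esymmOn_univ_mem_symmetricIdeal
    (Nat.lt_succ_of_le (p.2.2 j hj))) _ (Nat.pos_of_ne_zero hj)

lemma truncatedIdeal_sup_span_standardExponents (hr : 0 < r) :
    (truncatedIdeal R n N r M).restrictScalars R ⊔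
      Submodule.span R (Set.range fun a : standardExponents n N r M => monomial a.1 (1 : R)) =
        ⊤ := by
  rw [eq_top_iff, ← span_range_monomial, Submodule.span_le]
  rintro _ ⟨a, rfl⟩
  refine Submodule.span_le.2 ?_ (monomial_mem_span_normalElt (N := N) hr a)
  rintro _ ⟨p, -, rfl⟩
  by_cases hp : p.1.2 = 0
  · have hmonomial : normalElt R p = monomial p.1.1 1 := by simp [normalElt, hp]
    rw [hmonomial]
    by_cases hbound : ∀ i, p.1.1 i ≤ M
    · exact Submodule.mem_sup_right (Submodule.subset_span ⟨⟨p.1.1, p.2.1, hbound⟩, rfl⟩)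
    · obtain ⟨i, hi⟩ := not_forall.1 hbound
      exact Submodule.mem_sup_left (monomial_mem_truncatedIdeal_of_lt (not_le.1 hi))
  · exact Submodule.mem_sup_left (Ideal.mem_sup_right (normalElt_mem_symmetricIdeal hp))

lemma linearIndependent_mk_standardExponents (hr : 0 < r) (hM : (n - N) * r ≤ M) :
    LinearIndependent R fun a : standardExponents n N r M =>
      Ideal.Quotient.mkₐ R (truncatedIdeal R n N r M) (monomial a.1 1) := by
  let index : standardExponents n N r M → NormalIndex n N r := fun a => .ofReduced a.2.1
  have hindex : Function.Injective index := fun a a' h =>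
    Subtype.ext (by simpa only [index, lead_ofReduced] using congrArg lead h)
  have hli := linearIndependent_normalElt (n := n) (R := R) (N := N) hr
  refine LinearIndependent.map (f := (Ideal.Quotient.mkₐ R (truncatedIdeal R n N r M)).toLinearMap)
    (v := fun a : standardExponents n N r M => monomial a.1 1) ?_ ?_
  · simpa only [Function.comp_def, index, normalElt_ofReduced] using hli.comp _ hindex
  · have hker : LinearMap.ker (Ideal.Quotient.mkₐ R (truncatedIdeal R n N r M)).toLinearMap =
        (truncatedIdeal R n N r M).restrictScalars R := by
      ext f; simp [Ideal.Quotient.eq_zero_iff_mem]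
    rw [hker]
    refine Disjoint.mono ?_ (truncatedIdeal_le_span_normalElt hr hM)
      (hli.disjoint_span_image disjoint_compl_right)
    refine Submodule.span_mono ?_
    rintro _ ⟨a, rfl⟩
    exact ⟨index a, ⟨rfl, a.2.2⟩, normalElt_ofReduced _⟩

theorem exists_basis_quotient_truncatedIdeal (hr : 0 < r) (hM : (n - N) * r ≤ M) :
    ∃ b : Module.Basis (standardExponents n N r M) R
        (MvPolynomial (Fin n) R ⧸ truncatedIdeal R n N r M),
      ∀ a, b a = Ideal.Quotient.mk (truncatedIdeal R n N r M) (monomial a.1 1) := by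
  refine ⟨.mk (linearIndependent_mk_standardExponents hr hM) ?_, fun a => ?_⟩
  · rintro x -
    obtain ⟨f, rfl⟩ := Ideal.Quotient.mk_surjective x
    have htop : f ∈ (⊤ : Submodule R (MvPolynomial (Fin n) R)) := Submodule.mem_top
    rw [← truncatedIdeal_sup_span_standardExponents (N := N) (M := M) hr] at htop
    obtain ⟨g, hg, h, hh, rfl⟩ := Submodule.mem_sup.1 htop
    rw [map_add, Ideal.Quotient.eq_zero_iff_mem.2 hg, zero_add]
    have hmap := Submodule.mem_map_of_mem
      (f := (Ideal.Quotient.mkₐ R (truncatedIdeal R n N r M)).toLinearMap) hh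
    rwa [Submodule.map_span, ← Set.range_comp] at hmap
  · rw [Module.Basis.mk_apply]; rfl

end Bases

section Words

lemma idealI_eq_truncatedIdeal (n k r : ℕ) :
    idealI n k r = truncatedIdeal ℂ n (n - k) r (k * r) := by
  rw [truncatedIdeal, symmetricIdeal, ← Ideal.span_union, idealI]
  congr 2
  · ext f; simp [eq_comm]
  · ext f; simp [esymmOn_univ, esymmPow, eq_comm, and_assoc]

lemma gap_add_left {l : ℕ} (f : Fin l → ℕ) (z : ℕ) (p : Fin (l - z)) :
    gap (fun j : Fin (l - z) => f ⟨z + j, by omega⟩) p = gap f ⟨z + p, by omega⟩ := by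
  simp only [gap, next, ← add_assoc]
  by_cases h : (p : ℕ) + 1 < l - z
  · rw [dif_pos h, dif_pos (by omega)]
  · rw [dif_neg h, dif_neg (by omega)]

namespace ColoredPerm

variable {n r m k : ℕ} (g : ColoredPerm n r m)

/-- The colored letters are encoded by integers, in the reverse of the order of colored letters. -/
def colorKey (p : Fin m) : ℕ := n * g.color p + (g.letter p).rev

lemma colorKey_lt (p : Fin m) : g.colorKey p < r * n := by
  have hcolor : n * (g.color p + 1) ≤ n * r := Nat.mul_le_mul_left n (g.color p).isLt
  rw [colorKey, mul_comm r n]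
  rw [mul_add_one] at hcolor
  have := (g.letter p).rev.isLt
  omega

lemma colorKey_injective : Function.Injective g.colorKey := by
  intro p q h
  have hmod := congrArg (· % n) h
  simp only [colorKey, Nat.mul_add_mod, Nat.mod_eq_of_lt (Fin.isLt _)] at hmod
  exact g.letter.injective (Fin.rev_injective (Fin.ext hmod))

lemma coloredLT_entry_iff {p q : Fin m} :
    ColoredLT (g.entry q) (g.entry p) ↔ g.colorKey p < g.colorKey q := by
  have hp := (g.letter p).rev.isLt
  have hq := (g.letter q).rev.isLt
  rw [ColoredLT, entry, entry, colorKey, colorKey, ← Fin.rev_lt_rev (i := g.letter p), Fin.lt_def,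
    Fin.lt_def, Fin.ext_iff]
  dsimp only
  rcases lt_trichotomy (g.color p : ℕ) (g.color q) with h | h | h
  · have := Nat.mul_le_mul_left n (Nat.succ_le_of_lt h)
    simp only [h, true_or, true_iff]
    rw [Nat.mul_succ] at this
    omega
  · simp only [h]; simp
  · have := Nat.mul_le_mul_left n (Nat.succ_le_of_lt h)
    rw [Nat.mul_succ] at this
    constructor <;> intro <;> omega

lemma mem_Des {p : Fin m} : p ∈ g.Des ↔ g.colorKey p < next g.colorKey p := by
  simp only [Des, mem_filter, mem_univ, true_and, coloredLT_entry_iff, next]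
  split_ifs with h <;> simp [h]

lemma d_eq_sum (p : Fin m) :
    g.d p = ∑ j ∈ Ici p, if g.colorKey j < next g.colorKey j then 1 else 0 := by
  simp only [← mem_Des, ← sum_filter, sum_const, smul_eq_mul, mul_one, d]
  congr 1
  ext j
  simp [and_comm]

lemma d_eq_add_next (p : Fin m) :
    g.d p = (if g.colorKey p < next g.colorKey p then 1 else 0) + next g.d p := by
  rw [d_eq_sum, sum_Ici_eq_add_next, funext g.d_eq_sum]

lemma d_add_lt (p : Fin m) : g.d p + p < m := by
  have hsub : (g.Des.filter fun j => p ≤ j).map Fin.valEmbedding ⊆ Ico (p : ℕ) (m - 1) := by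
    intro j hj
    simp only [mem_map, mem_filter, Des, mem_univ, true_and, Fin.valEmbedding_apply] at hj
    obtain ⟨i, ⟨⟨hi, -⟩, hpi⟩, rfl⟩ := hj
    rw [mem_Ico]
    omega
  have hcard := card_le_card hsub
  rw [card_map, Nat.card_Ico] at hcard
  rw [d]
  omega

lemma d_le_des (p : Fin m) : g.d p ≤ g.des := card_filter_le _ _

lemma d_zero (hm : 0 < m) : g.d ⟨0, hm⟩ = g.des := by
  simp [d, des, Fin.le_def]

/-- The exponent vector of `∏ j ∈ Z, x_j^s` times the descent monomial of `g`, with the exponent of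
the `p`-th letter of `g` raised by `r * E p`. -/
def exponent (Z : Finset (Fin n)) (s : ℕ) (E : Fin m → ℕ) : Fin n →₀ ℕ :=
  block s Z + ∑ p, Finsupp.single (g.letter p) (r * (g.d p + E p) + g.color p)

lemma monomial_exponent (Z : Finset (Fin n)) (s : ℕ) {E : Fin m → ℕ}
    (hE : ∀ p : Fin m, m - k ≤ p → E p = 0) : monomial (g.exponent Z s E) (1 : ℂ) =
      (∏ j ∈ Z, X j ^ s) * g.extendedMonomial k fun j => E (Fin.castLE (Nat.sub_le m k) j) := by
  have hprod : ∏ j : Fin (m - k), X (g.letter (Fin.castLE (Nat.sub_le m k) j)) ^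
      (r * E (Fin.castLE (Nat.sub_le m k) j)) =
        ∏ p, (X (g.letter p) : MvPolynomial (Fin n) ℂ) ^ (r * E p) := by
    refine Fintype.prod_of_injective _ (Fin.castLE_injective _) _ _ (fun p hp => ?_) fun _ => rfl
    rw [hE p (not_lt.1 fun h => hp ⟨⟨p, h⟩, rfl⟩), mul_zero, pow_zero]
  rw [extendedMonomial, hprod, descentMonomial, ← prod_mul_distrib, exponent,
    ← mul_one (1 : ℂ), ← monomial_mul, monomial_block, monomial_sum_one]
  congr 1
  refine prod_congr rfl fun p _ => ?_
  rw [← X_pow_eq_monomial, ← pow_add]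
  congr 1
  ring

lemma key_letter {a : Fin n →₀ ℕ} {q : Fin m → ℕ}
    (ha : ∀ p, a (g.letter p) = r * q p + g.color p) (p : Fin m) :
    key a (g.letter p) = r * n * q p + g.colorKey p := by
  rw [key, ha, colorKey]
  ring

variable {Z : Finset (Fin n)} {s : ℕ} {E : Fin m → ℕ} (hZ : univ.map g.letter = Zᶜ)
include hZ

lemma letter_notMem (p : Fin m) : g.letter p ∉ Z := by
  rw [← mem_compl, ← hZ]
  exact mem_map_of_mem _ (mem_univ p)

lemma exists_letter_eq {i : Fin n} (hi : i ∉ Z) : ∃ p, g.letter p = i := by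
  have hmem : i ∈ univ.map g.letter := hZ ▸ mem_compl.2 hi
  simpa using hmem

lemma exponent_of_mem {i : Fin n} (hi : i ∈ Z) : g.exponent Z s E i = s := by
  have hne : ∀ p, g.letter p ≠ i := fun p h => g.letter_notMem hZ p (h ▸ hi)
  simp [exponent, block_apply, hi, hne]

lemma exponent_letter (p : Fin m) :
    g.exponent Z s E (g.letter p) = r * (g.d p + E p) + g.color p := by
  rw [exponent, Finsupp.add_apply, block_apply, if_neg (g.letter_notMem hZ p), zero_add,
    Finsupp.finsetSum_apply]
  simp only [Finsupp.single_apply, g.letter.injective.eq_iff]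
  rw [sum_ite_eq' _ _ _, if_pos (mem_univ p)]

lemma eq_exponent {a : Fin n →₀ ℕ} (hmem : ∀ i ∈ Z, a i = s)
    (hletter : ∀ p, a (g.letter p) = r * (g.d p + E p) + g.color p) : a = g.exponent Z s E := by
  ext i
  by_cases hi : i ∈ Z
  · rw [hmem i hi, g.exponent_of_mem hZ hi]
  · obtain ⟨p, rfl⟩ := g.exists_letter_eq hZ hi
    rw [hletter, g.exponent_letter hZ]

lemma exponent_le (hdes : g.des < k) (hE : ∀ p, E p < k - g.des) (i : Fin n) :
    g.exponent Z (k * r) E i ≤ k * r := by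
  by_cases hi : i ∈ Z
  · rw [g.exponent_of_mem hZ hi]
  · obtain ⟨p, rfl⟩ := g.exists_letter_eq hZ hi
    have hle : g.d p + E p + 1 ≤ k := by
      have := g.d_le_des p
      have := hE p
      omega
    have := Nat.mul_le_mul_left r hle
    have := (g.color p).isLt
    rw [g.exponent_letter hZ, mul_comm k]
    rw [mul_add_one] at *
    omega

lemma gap_key_exponent_lt {p : Fin m} (hE : ∀ j, p ≤ j → E j = 0) :
    gap (fun j => key (g.exponent Z s E) (g.letter j)) p < r * n := by
  have hpos : 0 < r * n := (Nat.zero_le _).trans_lt (g.colorKey_lt p)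
  have hq : g.d p + E p = 0 + (if g.colorKey p < next g.colorKey p then 1 else 0) +
      next (fun j => g.d j + E j) p := by
    have hnext : next (fun j => g.d j + E j) p = next g.d p := by
      unfold next
      split_ifs with h
      · simp only [hE ⟨p + 1, h⟩ (Fin.le_def.2 (Nat.le_succ _)), add_zero]
      · rfl
    rw [hnext, hE p le_rfl, add_zero, zero_add, ← d_eq_add_next]
  refine (Nat.div_eq_zero_iff_lt hpos).1 (gap_div_eq
    (q := fun j => g.d j + E j) (fun j => ?_) g.colorKey_lt g.colorKey_injective hq)
  exact g.key_letter (g.exponent_letter hZ) j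

lemma length_add_card : m + #Z = n := by
  have hcard := congrArg card hZ
  have hle := card_le_univ Z
  rw [card_map, card_univ, Fintype.card_fin, card_compl, Fintype.card_fin] at hcard
  rw [Fintype.card_fin] at hle
  omega

lemma exists_last_letter_mem {S : Finset (Fin n)} (hS : #Z < #S) :
    ∃ p, g.letter p ∈ S ∧ (∀ j, g.letter j ∈ S → j ≤ p) ∧ #S ≤ p + 1 + #Z := by
  have hsdiff : #S ≤ #(S \ Z) + #Z := tsub_le_iff_right.1 (le_card_sdiff Z S)
  have hne : (univ.filter fun p => g.letter p ∈ S).Nonempty := by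
    obtain ⟨i, hi⟩ := card_pos.1 (show 0 < #(S \ Z) by omega)
    obtain ⟨p, rfl⟩ := g.exists_letter_eq hZ (mem_sdiff.1 hi).2
    exact ⟨p, by simpa using (mem_sdiff.1 hi).1⟩
  obtain ⟨p, hpS, hmax⟩ := exists_max_image _ id hne
  simp only [mem_filter, mem_univ, true_and, id] at hpS hmax
  refine ⟨p, hpS, hmax, ?_⟩
  have hsub : S \ Z ⊆ (Iic p).map g.letter := fun i hi => by
    obtain ⟨j, rfl⟩ := g.exists_letter_eq hZ (mem_sdiff.1 hi).2
    exact mem_map_of_mem _ (mem_Iic.2 (hmax j (mem_sdiff.1 hi).1))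
  have hcard := card_le_card hsub
  rw [card_map, Fin.card_Iic] at hcard
  omega

lemma reduced_exponent (hcard : #Z ≤ n - k) (hE : ∀ p : Fin m, m - k ≤ p → E p = 0) :
    Reduced (n - k) r (g.exponent Z s E) := by
  intro P hP
  by_contra! hgap
  obtain ⟨c, S, hc, hS, hsep⟩ := exists_eq_add_block_of_le_keyGap hgap
  have hm := g.length_add_card hZ
  obtain ⟨p, hpS, hmax, hSp⟩ := g.exists_last_letter_mem hZ (S := S) (by omega)
  have hlast : m - k ≤ p := by omega
  refine (g.gap_key_exponent_lt (s := s) hZ fun j hj => hE j (hlast.trans hj)).not_ge ?_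
  rw [hc]
  simp only [gap, next, key_add_block, hpS, if_true]
  split_ifs with h h'
  · exact absurd (hmax _ h') (not_le.2 (Fin.lt_def.2 (Nat.lt_succ_self _)))
  · have := hsep _ hpS _ h'
    omega
  · omega

end ColoredPerm

end Words
section DescentMonomials

variable {n k r : ℕ}

namespace ColoredPerm

lemma map_letter_suffix (g : ColoredPerm n r n) (z : ℕ) :
    univ.map (g.suffix z).letter = ((univ.filter fun p : Fin n => p < z).map g.letter)ᶜ := by
  have hsurj : Function.Surjective g.letter := Finite.surjective_of_injective g.letter.injective
  ext i
  obtain ⟨p, rfl⟩ := hsurj i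
  rw [mem_compl, mem_map' g.letter, mem_filter_univ, not_lt, mem_map]
  constructor
  · rintro ⟨j, -, hj⟩
    rw [← g.letter.injective hj]
    exact Nat.le_add_right z j
  · intro hp
    exact ⟨⟨p - z, by omega⟩, mem_univ _, congrArg g.letter (Fin.ext (Nat.add_sub_cancel' hp))⟩

variable {m : ℕ} {g : ColoredPerm n r m} {a : Fin n →₀ ℕ}

lemma div_eq_sum_gap_add_d (hanti : StrictAnti fun p => key a (g.letter p))
    (hcolor : ∀ p, (g.color p : ℕ) = a (g.letter p) % r) (p : Fin m) :
    a (g.letter p) / r =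
      g.d p + ∑ j ∈ Ici p, gap (fun j => key a (g.letter j)) j / (r * n) := by
  have hkey := g.key_letter (q := fun p => a (g.letter p) / r) fun p => by
    rw [hcolor, Nat.div_add_mod]
  have hrec := eq_gap_div_add_next hanti hkey g.colorKey_lt g.colorKey_injective
  rw [eq_sum_Ici_of_eq_add_next hrec, sum_add_distrib, d_eq_sum, add_comm]

end ColoredPerm

/-- The word whose letters are the variables in the order of decreasing keys, each colored by the
residue of its exponent modulo `r`. -/
def word (hr : 0 < r) (a : Fin n →₀ ℕ) : ColoredPerm n r n where
  letter := (order a).toEmbedding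
  color p := ⟨a (order a p) % r, Nat.mod_lt _ hr⟩

variable {a : Fin n →₀ ℕ}

/-- The increments by which the exponents of the suffix of `word hr a` obtained by deleting the
first `z` letters exceed those of its descent monomial, in units of `r`. -/
def excess (r : ℕ) (a : Fin n →₀ ℕ) (z : ℕ) (p : Fin (n - z)) : ℕ :=
  ∑ j ∈ Ici p, keyGap a ⟨z + j, by omega⟩ / (r * n)

lemma excess_eq_zero (ha : Reduced (n - k) r a) {z : ℕ} {p : Fin (n - z)}
    (hp : n - z - k ≤ p) : excess r a z p = 0 :=
  sum_eq_zero fun j hj => Nat.div_eq_of_lt <| ha _ <| by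
    have : p ≤ j := mem_Ici.1 hj
    dsimp only
    omega

lemma div_eq_d_suffix_word_add_excess (hr : 0 < r) (a : Fin n →₀ ℕ) (z : ℕ) (p : Fin (n - z)) :
    a (((word hr a).suffix z).letter p) / r = ((word hr a).suffix z).d p + excess r a z p := by
  have hanti : StrictAnti fun p => key a (((word hr a).suffix z).letter p) := fun i j hij =>
    strictAnti_key_order a (Fin.lt_def.2 (Nat.add_lt_add_left hij z))
  have hdiv := ColoredPerm.div_eq_sum_gap_add_d hanti (fun _ => rfl) p
  simp only [excess, keyGap, ← gap_add_left]
  exact hdiv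

lemma antitone_order (a : Fin n →₀ ℕ) : Antitone fun p => a (order a p) := fun p q h => by
  simpa only [key_div] using Nat.div_le_div_right (c := n) ((strictAnti_key_order a).antitone h)

lemma exists_le_forall_lt_iff_mul_le (hr : 0 < r) (ha : Reduced (n - k) r a) :
    ∃ z ≤ n - k, ∀ p : Fin n, (p : ℕ) < z ↔ k * r ≤ a (order a p) := by
  have hlt : ∀ p : Fin n, (p : ℕ) < #{i | k * r ≤ a (order a i)} ↔ k * r ≤ a (order a p) :=
    fun p => Tuple.lt_card_ge_iff_apply_ge_of_antitone (antitone_order a)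
  refine ⟨_, ?_, hlt⟩
  by_contra! hz
  have hn : n - k < n := hz.trans_le ((card_filter_le _ _).trans_eq (card_fin n))
  have hdiv := div_eq_d_suffix_word_add_excess hr a (n - k) ⟨0, by omega⟩
  rw [excess_eq_zero ha (by dsimp only; omega), add_zero] at hdiv
  have hd := ((word hr a).suffix (n - k)).d_add_lt ⟨0, by omega⟩
  have hle := (Nat.le_div_iff_mul_le hr).2 ((hlt ⟨n - k, hn⟩).1 hz)
  exact (hle.trans_eq hdiv).not_gt (hd.trans_le (by omega))

lemma admissible_suffix_word (hr : 0 < r) (hk : 0 < k) {z : ℕ}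
    (hz : ∀ p, a (((word hr a).suffix z).letter p) < k * r) :
    ((word hr a).suffix z).des < k ∧ Antitone (excess r a z) ∧
      ∀ p, excess r a z p < k - ((word hr a).suffix z).des := by
  have hanti : Antitone (excess r a z) := antitone_sum_Ici _
  rcases Nat.eq_zero_or_pos (n - z) with h | h
  · have : IsEmpty (Fin (n - z)) := by rw [h]; infer_instance
    exact ⟨(card_le_univ _).trans_lt (by simpa [h] using hk), hanti, isEmptyElim⟩
  · have hsum := div_eq_d_suffix_word_add_excess hr a z ⟨0, h⟩
    rw [ColoredPerm.d_zero] at hsum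
    have hlt := (Nat.div_lt_iff_lt_mul hr).2 (hz ⟨0, h⟩)
    refine ⟨by omega, hanti, fun p => ?_⟩
    have := hanti (Fin.le_def.2 (Nat.zero_le p) : ⟨0, h⟩ ≤ p)
    omega

lemma eq_exponent_suffix_word (hr : 0 < r) {s z : ℕ} (ha : ∀ i, a i ≤ s)
    (hz : ∀ p : Fin n, p < z → s ≤ a (order a p)) :
    a = ((word hr a).suffix z).exponent
      ((univ.filter fun p : Fin n => p < z).map (word hr a).letter) s (excess r a z) := by
  refine ColoredPerm.eq_exponent _ (ColoredPerm.map_letter_suffix _ z) (fun i hi => ?_) fun p => ?_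
  · obtain ⟨p, hp, rfl⟩ := mem_map.1 hi
    exact (ha _).antisymm (hz p (mem_filter.1 hp).2)
  · rw [← div_eq_d_suffix_word_add_excess]
    exact (Nat.div_add_mod _ r).symm

lemma monomial_mem_extendedDescentMonomials (hr : 0 < r) (hk : 0 < k)
    (ha : a ∈ standardExponents n (n - k) r (k * r)) :
    monomial a 1 ∈ extendedDescentMonomials n k r := by
  obtain ⟨z, hzk, hz⟩ := exists_le_forall_lt_iff_mul_le hr ha.1
  obtain ⟨hdes, hanti, hlt⟩ := admissible_suffix_word (a := a) hr hk fun p =>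
    not_le.1 fun h => (Nat.le_add_right z p).not_gt ((hz ⟨z + p, by omega⟩).2 h)
  rw [extendedDescentMonomials, if_neg hk.ne']
  refine ⟨z, word hr a, fun j => excess r a z (Fin.castLE (Nat.sub_le _ k) j), hzk,
    ⟨hdes, hanti.comp_monotone (Fin.strictMono_castLE _).monotone, fun j => hlt _⟩, ?_⟩
  conv_lhs => rw [eq_exponent_suffix_word hr ha.2 fun p => (hz p).1]
  rw [ColoredPerm.monomial_exponent _ _ _ fun p hp => excess_eq_zero ha.1 hp, prod_map]

lemma exists_of_mem_extendedDescentMonomials (hk : 0 < k) {f : MvPolynomial (Fin n) ℂ}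
    (hf : f ∈ extendedDescentMonomials n k r) :
    ∃ Z : Finset (Fin n), #Z ≤ n - k ∧
      ∃ q ∈ descentMonomials n k r Zᶜ, f = (∏ j ∈ Z, X j ^ (k * r)) * q := by
  rw [extendedDescentMonomials, if_neg hk.ne'] at hf
  obtain ⟨z, g, e, hz, he, rfl⟩ := hf
  refine ⟨(univ.filter fun p : Fin n => p < z).map g.letter, ?_, _,
    ⟨_, g.suffix z, e, g.map_letter_suffix z, he, rfl⟩, by rw [prod_map]⟩
  rw [card_map, Fin.card_filter_val_lt]
  exact (min_le_right _ _).trans hz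

lemma exists_monomial_of_mem_descentMonomials {Z : Finset (Fin n)} (hZ : #Z ≤ n - k)
    {q : MvPolynomial (Fin n) ℂ} (hq : q ∈ descentMonomials n k r Zᶜ) :
    ∃ a ∈ standardExponents n (n - k) r (k * r),
      monomial a 1 = (∏ j ∈ Z, X j ^ (k * r)) * q := by
  obtain ⟨m, g, e, hg, ⟨hdes, -, he⟩, rfl⟩ := hq
  let E : Fin m → ℕ := Function.extend (Fin.castLE (Nat.sub_le m k)) e 0
  have hEe : ∀ j, E (Fin.castLE (Nat.sub_le m k) j) = e j :=
    (Fin.castLE_injective (Nat.sub_le m k)).extend_apply e 0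
  have hE : ∀ p : Fin m, m - k ≤ p → E p = 0 := fun p hp =>
    Function.extend_apply' _ _ _ fun ⟨j, hj⟩ => hp.not_gt (hj ▸ j.isLt)
  refine ⟨g.exponent Z (k * r) E, ⟨g.reduced_exponent hg hZ hE,
    g.exponent_le hg hdes fun p => ?_⟩, ?_⟩
  · rcases lt_or_ge (p : ℕ) (m - k) with hp | hp
    · exact (hEe ⟨p, hp⟩).trans_lt (he _)
    · rw [hE p hp]
      exact Nat.sub_pos_of_lt hdes
  · rw [g.monomial_exponent Z (k * r) hE]
    simp only [hEe]

lemma standardExponents_zero : standardExponents n n r 0 = {0} := by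
  ext a
  refine ⟨fun ha => Finsupp.ext fun i => Nat.le_zero.1 (ha.2 i), ?_⟩
  rintro rfl
  exact ⟨fun p hp => absurd p.isLt hp.not_gt, fun i => le_rfl⟩

lemma image_monomial_standardExponents (hr : 0 < r) :
    (fun a => monomial a (1 : ℂ)) '' standardExponents n (n - k) r (k * r) =
      extendedDescentMonomials n k r := by
  rcases Nat.eq_zero_or_pos k with rfl | hk
  · rw [Nat.sub_zero, zero_mul, standardExponents_zero, Set.image_singleton,
      extendedDescentMonomials, if_pos rfl]
    rfl
  · refine Set.Subset.antisymm (Set.image_subset_iff.2 fun a ha =>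
      monomial_mem_extendedDescentMonomials hr hk ha) fun f hf => ?_
    obtain ⟨Z, hZ, q, hq, rfl⟩ := exists_of_mem_extendedDescentMonomials hk hf
    exact exists_monomial_of_mem_descentMonomials hZ hq

lemma mem_extendedDescentMonomials_iff (hr : 0 < r) (hk : 0 < k) {f : MvPolynomial (Fin n) ℂ} :
    f ∈ extendedDescentMonomials n k r ↔ ∃ Z : Finset (Fin n), #Z ≤ n - k ∧
      ∃ q ∈ descentMonomials n k r Zᶜ, f = (∏ j ∈ Z, X j ^ (k * r)) * q := by
  refine ⟨exists_of_mem_extendedDescentMonomials hk, ?_⟩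
  rintro ⟨Z, hZ, q, hq, rfl⟩
  obtain ⟨a, ha, haq⟩ := exists_monomial_of_mem_descentMonomials hZ hq
  exact haq ▸ monomial_mem_extendedDescentMonomials hr hk ha

lemma exists_basis_ringR (hk : k ≤ n) (hr : 0 < r) :
    ∃ b : Module.Basis (extendedDescentMonomials n k r) ℂ (ringR n k r),
      ∀ f, b f = Ideal.Quotient.mk (idealI n k r) f.1 := by
  unfold ringR
  rw [idealI_eq_truncatedIdeal, ← image_monomial_standardExponents hr]
  obtain ⟨b, hb⟩ := exists_basis_quotient_truncatedIdeal (R := ℂ) (n := n) (N := n - k) hr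
    (Nat.mul_le_mul_right r (Nat.sub_sub_self hk).le)
  have hinj : Function.Injective fun a : Fin n →₀ ℕ => monomial a (1 : ℂ) :=
    monomial_left_injective one_ne_zero
  let φ := Equiv.Set.image _ (standardExponents n (n - k) r (k * r)) hinj
  refine ⟨b.reindex φ, fun f => ?_⟩
  obtain ⟨a, rfl⟩ := φ.surjective f
  rw [Module.Basis.reindex_apply, Equiv.symm_apply_apply, hb]
  rfl

end DescentMonomials

end DescentBasis

end

theorem mainTheorem8_general (n k r : ℕ) (hk : k ≤ n) (hr : 0 < r) :
    (∃ b : Module.Basis (DescentBasis.extendedDescentMonomials n k r) ℂ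
        (DescentBasis.ringR n k r),
      ∀ f : DescentBasis.extendedDescentMonomials n k r,
        b f = Ideal.Quotient.mk (DescentBasis.idealI n k r) (f : MvPolynomial (Fin n) ℂ)) ∧
    (1 ≤ k → ∀ f : MvPolynomial (Fin n) ℂ,
      f ∈ DescentBasis.extendedDescentMonomials n k r ↔
        ∃ Z : Finset (Fin n), Z.card ≤ n - k ∧
          ∃ q ∈ DescentBasis.descentMonomials n k r Zᶜ,
            f = (∏ j ∈ Z, MvPolynomial.X j ^ (k * r)) * q) :=
  ⟨DescentBasis.exists_basis_ringR hk hr,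
    fun hk' _ => DescentBasis.mem_extendedDescentMonomials_iff hr hk'⟩

theorem mainTheorem8 (n k r : ℕ) (hn : 1 ≤ n) (hk : k ≤ n) (hr : 2 ≤ r) :
    (∃ b : Module.Basis (DescentBasis.extendedDescentMonomials n k r) ℂ
        (DescentBasis.ringR n k r),
      ∀ f : DescentBasis.extendedDescentMonomials n k r,
        b f = Ideal.Quotient.mk (DescentBasis.idealI n k r) (f : MvPolynomial (Fin n) ℂ)) ∧
    (1 ≤ k → ∀ f : MvPolynomial (Fin n) ℂ,
      f ∈ DescentBasis.extendedDescentMonomials n k r ↔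
        ∃ Z : Finset (Fin n), Z.card ≤ n - k ∧
          ∃ q ∈ DescentBasis.descentMonomials n k r Zᶜ,
            f = (∏ j ∈ Z, MvPolynomial.X j ^ (k * r)) * q) :=
  mainTheorem8_general n k r hk (by omega)
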